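/- Let $\mathbb F$ be a field, $d\ge 0$, and let $\mathcal A=\{H_{\alpha_i,a_i}\mid i\in[m]\}$ be a finite set of hyperplanes $H_{\alpha_i,a_i}=\{x\in\mathbb F^d:\alpha_i\cdot x=a_i\}$ with $\alpha_i\neq 0$. Assume that $\mathcal A$ is essential, i.e. $\alpha_1,\dots,\alpha_m$ span $\mathbb F^d$. Notation. For an arrangement $\mathcal B$ (a finite set of affine subspaces, possibly including the empty set) in an affine space $V$, $L(\mathcal B)$ is the set of all nonempty intersections of members of $\mathcal B$ (including $V$), ordered by reverse inclusion; $\chi(\mathcal B,t)=\sum_{X\in L(\mathcal B)}\mu(V,X)\,t^{\dim X}$, where $\mu$ is the Möbius function of $L(\mathcal B)$, with $\chi(\mathcal B,t)=0$ if $V\in\mathcal B$; for $X\in L(\mathcal B)$, $\mathcal B/X=\{H\cap X\ne\emptyset\mid H\in\mathcal B,\ X\not\subseteq H\}$, an arrangement in $X$; and $M(\mathcal B)=V\setminus\bigcup_{H\in\mathcal B}H$. Let $\mathcal A^o=\{H_{\alpha_i,0}\mid i\in[m]\}$. The induced adjoint arrangement $\tilde{\mathcal A}$ in $\mathbb F^{d+1}$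 consists of the linear hyperplanes $(v,-1)\cdot y=0$ for all points $v$ with $\{v\}\in L(\mathcal A)$, and $(u,0)\cdot y=0$ for all lines $\mathbb Fu\in L(\mathcal A^o)$, $u\ne0$. For $(\alpha,a)\in\mathbb F^{d+1}$ let $\mathcal A+H_{\alpha,a}=\mathcal A\cup\{H_{\alpha,a}\}$, where $H_{\alpha,a}=\{x\in\mathbb F^d:\alpha\cdot x=a\}$ ($\alpha=0$ is allowed). For a field extension $K/\mathbb F$, let $\mathcal A_K$ be the arrangement in $K^d$ given by the same equations, and for $X\in L(\tilde{\mathcal A})$ let $X_K\subseteq K^{d+1}$ be the $K$-span of $X$. (a) Let $\mathbb F=\mathbb F_q$ be finite. For each $X\in L(\tilde{\mathcal A})$ there is a polynomial $\chi(X,t)\in\mathbb Z[t]$ such that $\chi(\mathcal A+H_{\alpha,a},t)=\chi(X,t)$ for all $(\alpha,a)\in M(\tilde{\mathcal A}/X)$ and, more generally, for every field extension $K/\mathbb F$, $\chi(\mathcal A_K+H_{\alpha,a},t)=\chi(X,t)$ for all $(\alpha,a)\in M(\widetilde{\mathcal A_K}/X_K)$; the set $M(\widetilde{\mathcal A_K}/X_K)$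 is nonempty whenever $K$ is infinite, so that $\chi(X,t)$ is uniquely determined. (b) Let $\mathbb F=\mathbb R$ and let $\mathcal A$ be rational, i.e. each hyperplane of $\mathcal A$ has an equation $\alpha\cdot x=a$ with $(\alpha,a)\in\mathbb Z^{d}\times\mathbb Z$. For each $X\in L(\tilde{\mathcal A})$ the set $M(\tilde{\mathcal A}/X)$ is nonempty and $\chi(\mathcal A+H_{\alpha,a},t)$ is the same polynomial, denoted $\chi(X,t)$, for all $(\alpha,a)\in M(\tilde{\mathcal A}/X)$. In both cases (a) and (b), the following identity holds in $\mathbb Z[t]$: $$\sum_{X\in L(\tilde{\mathcal A})}\chi(\tilde{\mathcal A}/X,t)\,\chi(X,t)=t^d(t-1)\,\chi(\mathcal A,t).$$ -/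

import Mathlib

universe u

namespace HypArr

open Polynomial

section Equations

variable {F : Type*} [Field F] {ι : Type*} [Fintype ι]

/-- The affine hyperplane `H_{α,a} = {x | α ⬝ x = a}` in `F^ι`. It is a genuine hyperplane
when `α ≠ 0`; it is empty for `α = 0`, `a ≠ 0`, and the whole space for `α = 0`, `a = 0`. -/
def hyperplane (α : ι → F) (a : F) : AffineSubspace F (ι → F) where
  carrier := {x | α ⬝ᵥ x = a}
  smul_vsub_vadd_mem' := by
    intro c p q r hp hq hr
    change α ⬝ᵥ p = a at hp
    change α ⬝ᵥ q = a at hq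
    change α ⬝ᵥ r = a at hr
    change α ⬝ᵥ (c • (p - q) + r) = a
    simp [dotProduct_add, dotProduct_smul, dotProduct_sub, hp, hq, hr]

/-- A hyperplane arrangement: a finite collection of genuine affine hyperplanes. -/
def IsArrangement (A : Finset (AffineSubspace F (ι → F))) : Prop :=
  ∀ H ∈ A, ∃ α : ι → F, α ≠ 0 ∧ ∃ a : F, H = hyperplane α a

/-- `A` is essential: the normal vectors of its hyperplanes span the whole space. -/
def IsEssential (A : Finset (AffineSubspace F (ι → F))) : Prop :=
  Submodule.span F {α : ι → F | ∃ a : F, hyperplane α a ∈ A} = ⊤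

/-- A real arrangement is rational if each of its hyperplanes is given by an equation
with integer coefficients. -/
def IsRational (A : Finset (AffineSubspace ℝ (ι → ℝ))) : Prop :=
  ∀ H ∈ A, ∃ (α : ι → ℤ) (a : ℤ), H = hyperplane (fun i => (α i : ℝ)) (a : ℝ)

end Equations

section General

variable {F : Type*} [Field F] {ι : Type*}

open Classical in
/-- The intersection semi-lattice `L(A)` of an arrangement `A` in the affine space `V`:
all nonempty intersections of members of `A`, including `V` as the empty intersection. -/
noncomputable def interLattice (V : AffineSubspace F (ι → F))
    (A : Finset (AffineSubspace F (ι → F))) : Finset (AffineSubspace F (ι → F)) :=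
  {X ∈ A.powerset.image (fun B => V ⊓ B.inf id) | X ≠ ⊥}

theorem self_mem_interLattice {V : AffineSubspace F (ι → F)}
    (A : Finset (AffineSubspace F (ι → F))) (hV : V ≠ ⊥) : V ∈ interLattice V A := by
  classical
  simp only [interLattice, Finset.mem_filter, Finset.mem_image, Finset.mem_powerset]
  exact ⟨⟨∅, by simp, by simp⟩, hV⟩

open Classical in
/-- The Möbius function of a finite collection of affine subspaces
ordered by reverse inclusion. -/
noncomputable def moebius (L : Finset (AffineSubspace F (ι → F))) (X Y : L) : ℤ :=
  letI : LocallyFiniteOrder (L)ᵒᵈ := Fintype.toLocallyFiniteOrder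
  IncidenceAlgebra.mu ℤ (OrderDual.toDual X) (OrderDual.toDual Y)

open Classical in
/-- The characteristic polynomial `χ(A,t) = ∑_{X ∈ L(A)} μ(V,X) t^{dim X}` of an arrangement `A`
in the nonempty affine space `V`, with the convention that it is `0` if `V ∈ A`. -/
noncomputable def charPoly (V : AffineSubspace F (ι → F))
    (A : Finset (AffineSubspace F (ι → F))) : ℤ[X] :=
  if h : V ≠ ⊥ ∧ V ∉ A then
    ∑ Y : interLattice V A,
      C (moebius (interLattice V A) ⟨V, self_mem_interLattice A h.1⟩ Y) *
        X ^ Module.finrank F (Y : AffineSubspace F (ι → F)).direction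
  else 0

open Classical in
/-- The restriction `A/Y = {H ∩ Y ≠ ∅ | H ∈ A, Y ⊄ H}`, an arrangement in `Y`. -/
noncomputable def restriction (A : Finset (AffineSubspace F (ι → F)))
    (Y : AffineSubspace F (ι → F)) : Finset (AffineSubspace F (ι → F)) :=
  {Z ∈ {H ∈ A | ¬ Y ≤ H}.image (fun H => H ⊓ Y) | Z ≠ ⊥}

/-- The complement `M(A) = V \ ⋃_{H ∈ A} H` of an arrangement in `V`. -/
def complement (V : AffineSubspace F (ι → F)) (A : Finset (AffineSubspace F (ι → F))) :
    Set (ι → F) :=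
  {x | x ∈ V ∧ ∀ H ∈ A, x ∉ H}

open Classical in
/-- The linearization `A°`: each `H_{α,a}` is replaced by the parallel linear hyperplane `H_{α,0}`,
which is the direction of `H_{α,a}`. -/
noncomputable def linearization (A : Finset (AffineSubspace F (ι → F))) :
    Finset (AffineSubspace F (ι → F)) :=
  A.image (fun H => H.direction.toAffineSubspace)

/-- Extension of scalars of an affine subspace of `F^ι` along a field extension `K / F`:
the `K`-affine span of its `F`-points (for `H_{α,a}` with `α ≠ 0`, the hyperplane of `K^ι` with
the same equation). -/
noncomputable def baseChange (K : Type*) [Field K] [Algebra F K]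
    (Y : AffineSubspace F (ι → F)) : AffineSubspace K (ι → K) :=
  affineSpan K ((fun x : ι → F => fun i => algebraMap F K (x i)) '' (Y : Set (ι → F)))

open Classical in
/-- An arrangement over `F`, regarded as an arrangement over an extension field `K`. -/
noncomputable def baseChangeArr (K : Type*) [Field K] [Algebra F K]
    (A : Finset (AffineSubspace F (ι → F))) : Finset (AffineSubspace K (ι → K)) :=
  A.image (baseChange K)

end General

section Adjoint

variable {F : Type*} [Field F] {d : ℕ}

/-- The vector `(α, a) ∈ F^{d+1}`. -/
def pair (α : Fin d → F) (a : F) : Fin (d + 1) → F :=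
  Fin.snoc (α := fun _ => F) α a

/-- The hyperplanes of the induced adjoint arrangement: `H_{(v,-1),0}` for the vertices `v` of `A`
(`{v}` a `0`-dimensional member of `L(A)`), and `H_{(u,0),0}` for the lines `F u` (`u ≠ 0`) that are
`1`-dimensional members of `L(A°)`. -/
def adjointSet (A : Finset (AffineSubspace F (Fin d → F))) :
    Set (AffineSubspace F (Fin (d + 1) → F)) :=
  {H | ∃ v : Fin d → F, AffineSubspace.mk' v ⊥ ∈ interLattice ⊤ A ∧
      H = hyperplane (pair v (-1)) 0} ∪
  {H | ∃ u : Fin d → F, u ≠ 0 ∧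
      (Submodule.span F {u}).toAffineSubspace ∈ interLattice ⊤ (linearization A) ∧
      H = hyperplane (pair u 0) 0}

theorem adjointSet_finite (A : Finset (AffineSubspace F (Fin d → F))) :
    (adjointSet A).Finite := by
  classical
  refine Set.Finite.union ?_ ?_
  · let f : AffineSubspace F (Fin d → F) → AffineSubspace F (Fin (d + 1) → F) := fun Z =>
      if h : ∃ v : Fin d → F, Z = AffineSubspace.mk' v ⊥ then
        hyperplane (pair h.choose (-1)) 0 else ⊥
    refine ((interLattice ⊤ A).finite_toSet.image f).subset ?_
    rintro H ⟨v, hv, rfl⟩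
    refine ⟨_, hv, ?_⟩
    have h : ∃ w : Fin d → F, AffineSubspace.mk' v ⊥ = AffineSubspace.mk' w (⊥ : Submodule F _) :=
      ⟨v, rfl⟩
    have hw : v = h.choose := by
      have h1 : v ∈ AffineSubspace.mk' v (⊥ : Submodule F (Fin d → F)) :=
        AffineSubspace.self_mem_mk' _ _
      rw [h.choose_spec, AffineSubspace.mem_mk'] at h1
      simpa [sub_eq_zero] using h1
    simp only [f, dif_pos h]
    rw [← hw]
  · let f : AffineSubspace F (Fin d → F) → AffineSubspace F (Fin (d + 1) → F) := fun Z =>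
      if h : ∃ u : Fin d → F, u ≠ 0 ∧ Z = (Submodule.span F {u}).toAffineSubspace then
        hyperplane (pair h.choose 0) 0 else ⊥
    refine ((interLattice ⊤ (linearization A)).finite_toSet.image f).subset ?_
    rintro H ⟨v, hv0, hv, rfl⟩
    refine ⟨_, hv, ?_⟩
    have h : ∃ w : Fin d → F, w ≠ 0 ∧ (Submodule.span F {v}).toAffineSubspace =
      (Submodule.span F {w}).toAffineSubspace := ⟨v, hv0, rfl⟩
    have h1 : h.choose ∈ Submodule.span F {v} :=
      (SetLike.ext_iff.1 h.choose_spec.2 h.choose).2 (Submodule.mem_span_singleton_self h.choose)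
    obtain ⟨c, hc⟩ := Submodule.mem_span_singleton.1 h1
    have hc0 : c ≠ 0 := by
      rintro rfl
      exact h.choose_spec.1 (by rw [← hc, zero_smul])
    have hp : pair h.choose 0 = c • pair v 0 := by
      rw [← hc]
      ext i
      refine Fin.lastCases ?_ (fun j => ?_) i <;> simp [pair]
    simp only [f, dif_pos h]
    rw [hp]
    ext x
    change (c • pair v 0) ⬝ᵥ x = 0 ↔ pair v 0 ⬝ᵥ x = 0
    simp [smul_dotProduct, hc0]

/-- The induced adjoint arrangement of `A`, a linear arrangement in `F^{d+1}`. -/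
noncomputable def adjoint (A : Finset (AffineSubspace F (Fin d → F))) :
    Finset (AffineSubspace F (Fin (d + 1) → F)) :=
  (adjointSet_finite A).toFinset

open Classical in
/-- The one-element extension `A + H_{α,a}`, as a function of the point `P = (α, a) ∈ F^{d+1}`. -/
noncomputable def oneExt (A : Finset (AffineSubspace F (Fin d → F))) (P : Fin (d + 1) → F) :
    Finset (AffineSubspace F (Fin d → F)) :=
  insert (hyperplane (fun i : Fin d => P i.castSucc) (P (Fin.last d))) A

/-- The stratum `M(Ã/Y) ⊆ F^{d+1}` of a flat `Y` of the induced adjoint arrangement `Ã`. -/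
def stratum (A : Finset (AffineSubspace F (Fin d → F)))
    (Y : AffineSubspace F (Fin (d + 1) → F)) : Set (Fin (d + 1) → F) :=
  complement Y (restriction (adjoint A) Y)

/-- `p` is the characteristic polynomial of every `A + H_{α,a}` with `(α,a)` in the stratum
of `Y`. -/
def IsCommonCharPoly (A : Finset (AffineSubspace F (Fin d → F)))
    (Y : AffineSubspace F (Fin (d + 1) → F)) (p : ℤ[X]) : Prop :=
  ∀ P ∈ stratum A Y, charPoly ⊤ (oneExt A P) = p

end Adjoint

end HypArr

/-!
By Whitney's theorem, `χ(A + H_{α,a}, t)` is the sum over all `B ⊆ A` of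
`(-1)^|B| (t^dim Z - t^dim(Z ∩ H_{α,a}))`, where `Z` is the intersection of `B`. The bracket depends
only on whether `(α, a)` lies in the space `E` of all `(α, a)` with `α` vanishing on the direction
of `Z`, and whether it lies in the subspace `C ⊆ E` of all `(α, a)` with `Z ⊆ H_{α,a}`. As `A` is
essential, every flat `Z` contains a vertex and its direction is spanned by lines of `L(A°)`, so
that `E` and `C` are flats of the adjoint arrangement `Ã`. Hence the bracket is constant on the
stratum of each flat `Y` of `Ã`, with a value determined by whether `Y ⊆ E` and `Y ⊆ C`. Möbius
inversion, `∑_{Y ⊆ E} χ(Ã/Y, t) = t^dim E`, then evaluates the sum over `Y`, one `B` at a time.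

Along a field extension `K / F`, a point of `K^ι` lies in the base change of a flat exactly when
every `F`-linear `f : K → F` with `f 1 = 1`, applied coordinatewise, maps it into that flat. So base
change commutes with intersections, and the combinatorial description carries over to `K`.
-/

namespace HypArr

open Polynomial

section Flats

variable {F : Type*} [Field F] {ι : Type*} {A B : Finset (AffineSubspace F (ι → F))}
  {V Y Z E H : AffineSubspace F (ι → F)}

theorem ne_bot_of_mem {x : ι → F} (hx : x ∈ Z) : Z ≠ ⊥ :=
  (AffineSubspace.nonempty_iff_ne_bot Z).1 ⟨x, hx⟩

theorem mem_finset_inf {x : ι → F} : x ∈ B.inf id ↔ ∀ H ∈ B, x ∈ H := by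
  classical
  induction B using Finset.induction_on with
  | empty => simp
  | insert H B _ ih => simp [Finset.inf_insert, AffineSubspace.mem_inf_iff, ih]

theorem mem_interLattice_iff :
    Y ∈ interLattice V A ↔
      Y ≠ ⊥ ∧ Y ≤ V ∧ ∀ x ∈ V, (∀ H ∈ A, Y ≤ H → x ∈ H) → x ∈ Y := by
  classical
  simp only [interLattice, Finset.mem_filter, Finset.mem_image, Finset.mem_powerset]
  rw [and_comm]
  refine and_congr_right fun _ => ⟨?_, fun ⟨hYV, hY⟩ => ⟨A.filter (Y ≤ ·),
    Finset.filter_subset _ _, le_antisymm (fun x hx => ?_) ?_⟩⟩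
  · rintro ⟨B, hB, rfl⟩
    exact ⟨inf_le_left, fun x hxV hx => (AffineSubspace.mem_inf_iff _ _ _).2 ⟨hxV,
      mem_finset_inf.2 fun H hH => hx H (hB hH) (inf_le_right.trans (Finset.inf_le hH))⟩⟩
  · obtain ⟨hxV, hx⟩ := (AffineSubspace.mem_inf_iff _ _ _).1 hx
    exact hY x hxV fun H hH hYH => mem_finset_inf.1 hx H (Finset.mem_filter.2 ⟨hH, hYH⟩)
  · exact le_inf hYV (Finset.le_inf fun H hH => (Finset.mem_filter.1 hH).2)

theorem inf_finset_inf_mem_interLattice (hB : B ⊆ A) (hne : V ⊓ B.inf id ≠ ⊥) :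
    V ⊓ B.inf id ∈ interLattice V A := by
  classical
  simp only [interLattice, Finset.mem_filter, Finset.mem_image, Finset.mem_powerset]
  exact ⟨⟨B, hB, rfl⟩, hne⟩

theorem inf_mem_interLattice (hZ : Z ∈ interLattice V A) (hH : H ∈ A) (hne : Z ⊓ H ≠ ⊥) :
    Z ⊓ H ∈ interLattice V A := by
  obtain ⟨-, hZV, hZ⟩ := mem_interLattice_iff.1 hZ
  refine mem_interLattice_iff.2 ⟨hne, inf_le_left.trans hZV, fun x hxV hx => ?_⟩
  exact (AffineSubspace.mem_inf_iff _ _ _).2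
    ⟨hZ x hxV fun H' hH' hZH' => hx H' hH' (inf_le_left.trans hZH'), hx H hH inf_le_right⟩

theorem mem_restriction :
    Z ∈ restriction A Y ↔ Z ≠ ⊥ ∧ ∃ H ∈ A, ¬ Y ≤ H ∧ H ⊓ Y = Z := by
  classical
  simp only [restriction, Finset.mem_filter, Finset.mem_image, and_assoc]
  exact and_comm

theorem not_le_of_mem_restriction (hZ : Z ∈ restriction A Y) : ¬ Y ≤ Z := by
  obtain ⟨-, H, -, hYH, rfl⟩ := mem_restriction.1 hZ
  exact fun h => hYH (h.trans inf_le_left)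

theorem mem_interLattice_restriction (hY : Y ∈ interLattice V A) :
    Z ∈ interLattice Y (restriction A Y) ↔ Z ∈ interLattice V A ∧ Z ≤ Y := by
  obtain ⟨-, hYV, hY⟩ := mem_interLattice_iff.1 hY
  simp only [mem_interLattice_iff]
  constructor
  · rintro ⟨hne, hZY, hZ⟩
    refine ⟨⟨hne, hZY.trans hYV, fun x hxV hx => ?_⟩, hZY⟩
    have hxY : x ∈ Y := hY x hxV fun H hH hYH => hx H hH (hZY.trans hYH)
    refine hZ x hxY fun H' hH' hZH' => ?_
    obtain ⟨-, H, hH, -, rfl⟩ := mem_restriction.1 hH'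
    exact (AffineSubspace.mem_inf_iff _ _ _).2 ⟨hx H hH (hZH'.trans inf_le_left), hxY⟩
  · rintro ⟨⟨hne, -, hZ⟩, hZY⟩
    refine ⟨hne, hZY, fun x hxY hx => hZ x (hYV hxY) fun H hH hZH => ?_⟩
    by_cases hYH : Y ≤ H
    · exact hYH hxY
    · have hHY : H ⊓ Y ≠ ⊥ := ne_bot_of_le_ne_bot hne (le_inf hZH hZY)
      exact ((AffineSubspace.mem_inf_iff _ _ _).1 (hx _ (mem_restriction.2 ⟨hHY, H, hH, hYH, rfl⟩)
        (le_inf hZH hZY))).1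

theorem mem_iff_le_of_mem_complement_restriction (hE : E ∈ interLattice V A) (hYV : Y ≤ V)
    {x : ι → F} (hx : x ∈ complement Y (restriction A Y)) : x ∈ E ↔ Y ≤ E := by
  refine ⟨fun hxE y hy => (mem_interLattice_iff.1 hE).2.2 y (hYV hy) fun H hH hEH => ?_,
    fun h => h hx.1⟩
  by_contra hyH
  have hxHY : x ∈ H ⊓ Y := (AffineSubspace.mem_inf_iff _ _ _).2 ⟨hEH hxE, hx.1⟩
  exact hx.2 _ (mem_restriction.2 ⟨ne_bot_of_mem hxHY, H, hH, fun h => hyH (h hy), rfl⟩) hxHY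

theorem lineMap_mem_at_most_once {x y : ι → F} (hxy : ¬ (x ∈ H ∧ y ∈ H)) :
    {t : F | AffineMap.lineMap x y t ∈ H}.Subsingleton := by
  intro s hs t ht
  by_contra hst
  apply hxy
  have hline : ∀ r : F, AffineMap.lineMap x y r ∈ H := by
    intro r
    have h := AffineMap.lineMap_mem ((r - s) / (t - s)) hs ht
    rwa [← AffineMap.apply_lineMap, AffineMap.lineMap_apply_ring',
      div_mul_cancel₀ _ (sub_ne_zero.2 (Ne.symm hst)), sub_add_cancel] at h
  exact ⟨by simpa using hline 0, by simpa using hline 1⟩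

theorem complement_nonempty [Infinite F] (hV : V ≠ ⊥) (hA : ∀ H ∈ A, ¬ V ≤ H) :
    (complement V A).Nonempty := by
  classical
  induction A using Finset.induction_on with
  | empty =>
    obtain ⟨x, hx⟩ := (AffineSubspace.nonempty_iff_ne_bot V).2 hV
    exact ⟨x, hx, by simp⟩
  | insert H A _ ih =>
    obtain ⟨x, hxV, hxA⟩ := ih fun H' hH' => hA H' (Finset.mem_insert_of_mem hH')
    obtain ⟨y, hyV, hyH⟩ := SetLike.not_le_iff_exists.1 (hA H (Finset.mem_insert_self H A))
    have hfin : (⋃ H' ∈ insert H A, {t : F | AffineMap.lineMap x y t ∈ H'}).Finite := by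
      refine (Finset.finite_toSet _).biUnion fun H' hH' => (lineMap_mem_at_most_once ?_).finite
      rintro ⟨hx', hy'⟩
      rcases Finset.mem_insert.1 hH' with rfl | hH'
      exacts [hyH hy', hxA H' hH' hx']
    obtain ⟨t, ht⟩ := hfin.exists_notMem
    exact ⟨_, AffineMap.lineMap_mem t hxV hyV,
      fun H' hH' h => ht (Set.mem_biUnion hH' h)⟩

theorem complement_restriction_nonempty [Infinite F] (hY : Y ≠ ⊥) :
    (complement Y (restriction A Y)).Nonempty :=
  complement_nonempty hY fun _ => not_le_of_mem_restriction

end Flats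

section CharPoly

variable {F : Type*} [Field F] {ι : Type*} {A B : Finset (AffineSubspace F (ι → F))}
  {V Y E H : AffineSubspace F (ι → F)}

open Classical in
/-- The Möbius function of a finite collection of affine subspaces, extended by zero to all pairs
of affine subspaces. -/
noncomputable def moebiusExt (L : Finset (AffineSubspace F (ι → F)))
    (Y Z : AffineSubspace F (ι → F)) : ℤ :=
  if h : Y ∈ L ∧ Z ∈ L then moebius L ⟨Y, h.1⟩ ⟨Z, h.2⟩ else 0

open Classical in
theorem sum_moebiusExt {L : Finset (AffineSubspace F (ι → F))} {Y Z : AffineSubspace F (ι → F)}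
    (hY : Y ∈ L) (hZ : Z ∈ L) :
    ∑ W ∈ L with Z ≤ W ∧ W ≤ Y, moebiusExt L W Z = if Y = Z then 1 else 0 := by
  let _ : LocallyFiniteOrder (L)ᵒᵈ := Fintype.toLocallyFiniteOrder
  have h := IncidenceAlgebra.sum_Icc_mu_left (𝕜 := ℤ)
    (OrderDual.toDual (⟨Y, hY⟩ : L)) (OrderDual.toDual (⟨Z, hZ⟩ : L))
  simp only [OrderDual.toDual_inj, Subtype.mk.injEq] at h
  rw [← h]
  refine Finset.sum_bij' (fun W hW => OrderDual.toDual (⟨W, (Finset.mem_filter.1 hW).1⟩ : L))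
    (fun W _ => (OrderDual.ofDual W : L).1) ?_ ?_ (fun _ _ => rfl) (fun _ _ => rfl) ?_
  · exact fun W hW => Finset.mem_Icc.2 (Finset.mem_filter.1 hW).2.symm
  · exact fun W hW => Finset.mem_filter.2 ⟨(OrderDual.ofDual W).2, (Finset.mem_Icc.1 hW).symm⟩
  · intro W hW
    rw [moebiusExt, dif_pos ⟨(Finset.mem_filter.1 hW).1, hZ⟩]
    rfl

theorem moebiusExt_congr {L L' : Finset (AffineSubspace F (ι → F))}
    {V Z : AffineSubspace F (ι → F)} (h : ∀ W ≤ V, W ∈ L ↔ W ∈ L') (hZ : Z ∈ L) {Y}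
    (hY : Y ∈ L) (hZY : Z ≤ Y) (hYV : Y ≤ V) : moebiusExt L Y Z = moebiusExt L' Y Z := by
  classical
  suffices H : ∀ Y : L, Z ≤ Y → (Y : AffineSubspace F (ι → F)) ≤ V →
      moebiusExt L Y Z = moebiusExt L' Y Z from H ⟨Y, hY⟩ hZY hYV
  clear! Y
  rintro ⟨Y, hY⟩
  induction hY' : (⟨Y, hY⟩ : L) using WellFoundedLT.induction generalizing Y with
  | ind _ ih =>
  subst hY'
  intro hZY hYV
  set I := L.filter (fun W => Z ≤ W ∧ W ≤ Y) with hI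
  have hIL' : I = L'.filter (fun W => Z ≤ W ∧ W ≤ Y) := by
    ext W
    simp only [hI, Finset.mem_filter]
    exact and_congr_left fun hW => h W (hW.2.trans hYV)
  have hYI : Y ∈ I := Finset.mem_filter.2 ⟨hY, hZY, le_rfl⟩
  have hsum : ∑ W ∈ I, moebiusExt L W Z = ∑ W ∈ I, moebiusExt L' W Z := by
    rw [sum_moebiusExt hY hZ, hIL',
      sum_moebiusExt ((h Y hYV).1 hY) ((h Z (hZY.trans hYV)).1 hZ)]
  have hbelow : ∑ W ∈ I.erase Y, moebiusExt L W Z = ∑ W ∈ I.erase Y, moebiusExt L' W Z := by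
    refine Finset.sum_congr rfl fun W hW => ?_
    obtain ⟨hWY, hWL, hZW, hWY'⟩ : W ≠ Y ∧ W ∈ L ∧ Z ≤ W ∧ W ≤ Y := by
      simpa [hI] using hW
    exact ih ⟨W, hWL⟩ (Subtype.mk_lt_mk.2 (lt_of_le_of_ne hWY' hWY)) W hWL rfl hZW (hWY'.trans hYV)
  rw [← Finset.add_sum_erase _ _ hYI, ← Finset.add_sum_erase _ _ hYI, hbelow] at hsum
  exact add_right_cancel hsum

open Classical in
/-- The monomial `t ^ dim Z`, read as `0` for the empty affine subspace. -/
noncomputable def dimMonomial (Z : AffineSubspace F (ι → F)) : ℤ[X] :=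
  if Z = ⊥ then 0 else X ^ Module.finrank F Z.direction

theorem dimMonomial_of_ne_bot (hY : Y ≠ ⊥) :
    dimMonomial Y = X ^ Module.finrank F Y.direction :=
  if_neg hY

theorem dimMonomial_bot : dimMonomial (⊥ : AffineSubspace F (ι → F)) = 0 :=
  if_pos rfl

theorem charPoly_eq_sum (hV : V ≠ ⊥) (hVA : V ∉ A) :
    charPoly V A =
      ∑ Z ∈ interLattice V A, C (moebiusExt (interLattice V A) V Z) * dimMonomial Z := by
  rw [charPoly, dif_pos ⟨hV, hVA⟩, ← Finset.sum_coe_sort (interLattice V A)]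
  refine Finset.sum_congr rfl fun Z _ => ?_
  rw [moebiusExt, dif_pos ⟨self_mem_interLattice A hV, Z.2⟩,
    dimMonomial_of_ne_bot (mem_interLattice_iff.1 Z.2).1]

open Classical in
theorem charPoly_restriction (hY : Y ∈ interLattice V A) :
    charPoly Y (restriction A Y) =
      ∑ Z ∈ interLattice V A with Z ≤ Y, C (moebiusExt (interLattice V A) Y Z) * dimMonomial Z := by
  have hYne : Y ≠ ⊥ := (mem_interLattice_iff.1 hY).1
  have hL : interLattice Y (restriction A Y) = {Z ∈ interLattice V A | Z ≤ Y} := by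
    ext Z
    rw [Finset.mem_filter, mem_interLattice_restriction hY]
  rw [charPoly_eq_sum hYne fun h => not_le_of_mem_restriction h le_rfl, hL]
  refine Finset.sum_congr rfl fun Z hZ => ?_
  rw [← hL] at hZ ⊢
  rw [moebiusExt_congr (L' := interLattice V A) (V := Y)
    (fun W hW => (mem_interLattice_restriction hY).trans (and_iff_left hW)) hZ
    (self_mem_interLattice _ hYne) (mem_interLattice_iff.1 hZ).2.1 le_rfl]

open Classical in
theorem sum_charPoly_restriction (hE : E ∈ interLattice V A) :
    ∑ Y ∈ interLattice V A with Y ≤ E, charPoly Y (restriction A Y) = dimMonomial E := by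
  set L := interLattice V A
  calc ∑ Y ∈ L with Y ≤ E, charPoly Y (restriction A Y)
    _ = ∑ Y ∈ L with Y ≤ E, ∑ Z ∈ L with Z ≤ Y, C (moebiusExt L Y Z) * dimMonomial Z :=
      Finset.sum_congr rfl fun Y hY => charPoly_restriction (Finset.mem_filter.1 hY).1
    _ = ∑ Z ∈ L, ∑ Y ∈ L with Z ≤ Y ∧ Y ≤ E, C (moebiusExt L Y Z) * dimMonomial Z :=
      Finset.sum_comm' fun Y Z => by simp only [Finset.mem_filter]; tauto
    _ = ∑ Z ∈ L, if E = Z then dimMonomial Z else 0 := by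
      refine Finset.sum_congr rfl fun Z hZ => ?_
      rw [← Finset.sum_mul, ← map_sum, sum_moebiusExt hE hZ]
      split_ifs <;> simp
    _ = dimMonomial E := by rw [Finset.sum_ite_eq, if_pos hE]

open Classical in
theorem dimMonomial_inf_finset_inf (hB : B ⊆ A) :
    dimMonomial (V ⊓ B.inf id) =
      ∑ Y ∈ interLattice V A with Y ≤ B.inf id, charPoly Y (restriction A Y) := by
  by_cases hne : V ⊓ B.inf id = ⊥
  · rw [hne, dimMonomial_bot, Finset.sum_filter, Finset.sum_eq_zero]
    intro Y hY
    obtain ⟨hY, hYV, -⟩ := mem_interLattice_iff.1 hY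
    exact if_neg fun h => ne_bot_of_le_ne_bot hY (le_inf hYV h) hne
  · rw [← sum_charPoly_restriction (inf_finset_inf_mem_interLattice hB hne)]
    refine Finset.sum_congr (Finset.filter_congr fun Y hY => ?_) fun _ _ => rfl
    exact le_inf_iff.trans (and_iff_right (mem_interLattice_iff.1 hY).2.1)

theorem sum_powerset_inf_eq_zero (hH : H ∈ A) :
    ∑ B ∈ A.powerset, (-1 : ℤ[X]) ^ B.card * dimMonomial (B.inf id ⊓ H) = 0 := by
  classical
  obtain ⟨A, hA, rfl⟩ : ∃ A', H ∉ A' ∧ insert H A' = A :=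
    ⟨A.erase H, by simp, Finset.insert_erase hH⟩
  rw [Finset.sum_powerset_insert hA, ← Finset.sum_add_distrib]
  refine Finset.sum_eq_zero fun B hB => ?_
  have hHB : H ∉ B := fun h => hA (Finset.mem_powerset.1 hB h)
  have hinf : (insert H B).inf id ⊓ H = B.inf id ⊓ H := by
    rw [Finset.inf_insert, id, inf_comm H, inf_assoc, inf_idem]
  rw [Finset.card_insert_of_notMem hHB, hinf]
  ring

open Classical in
theorem sum_powerset_le_inf (A : Finset (AffineSubspace F (ι → F)))
    (Y : AffineSubspace F (ι → F)) :
    ∑ B ∈ A.powerset with Y ≤ B.inf id, (-1 : ℤ[X]) ^ B.card =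
      if ∀ H ∈ A, ¬ Y ≤ H then 1 else 0 := by
  have hfilter : {B ∈ A.powerset | Y ≤ B.inf id} = {H ∈ A | Y ≤ H}.powerset := by
    ext B
    simp only [Finset.mem_filter, Finset.mem_powerset, Finset.le_inf_iff, id, Finset.subset_iff]
    grind
  rw [hfilter]
  simp only [← Finset.filter_eq_empty_iff]
  exact_mod_cast congrArg (Int.cast : ℤ → ℤ[X])
    (Finset.sum_powerset_neg_one_pow_card (x := {H ∈ A | Y ≤ H}))

theorem charPoly_restriction_self (hV : V ≠ ⊥) (hVA : V ∉ A) :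
    charPoly V (restriction A V) = charPoly V A := by
  classical
  rw [charPoly_restriction (self_mem_interLattice A hV), charPoly_eq_sum hV hVA,
    Finset.filter_true_of_mem fun Z hZ => (mem_interLattice_iff.1 hZ).2.1]

theorem charPoly_eq_sum_powerset (hV : V ≠ ⊥) (hA : ∀ H ∈ A, V ≤ H → H = V) :
    charPoly V A = ∑ B ∈ A.powerset, (-1 : ℤ[X]) ^ B.card * dimMonomial (V ⊓ B.inf id) := by
  classical
  by_cases hVA : V ∈ A
  · rw [charPoly, dif_neg fun h => h.2 hVA]
    simpa only [inf_comm V] using (sum_powerset_inf_eq_zero hVA).symm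
  set L := interLattice V A
  set χ := fun Y => charPoly Y (restriction A Y)
  have hnotLe : ∀ Y ∈ L, (∀ H ∈ A, ¬ Y ≤ H) ↔ Y = V := by
    intro Y hY
    obtain ⟨-, hYV, hY⟩ := mem_interLattice_iff.1 hY
    refine ⟨fun h => ?_, ?_⟩
    · exact le_antisymm hYV fun x hx => hY x hx fun H hH hYH => absurd hYH (h H hH)
    · rintro rfl H hH hYH
      exact hVA (hA H hH hYH ▸ hH)
  symm
  calc ∑ B ∈ A.powerset, (-1 : ℤ[X]) ^ B.card * dimMonomial (V ⊓ B.inf id)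
    _ = ∑ B ∈ A.powerset, ∑ Y ∈ L with Y ≤ B.inf id, (-1 : ℤ[X]) ^ B.card * χ Y :=
      Finset.sum_congr rfl fun B hB => by
        rw [dimMonomial_inf_finset_inf (Finset.mem_powerset.1 hB), Finset.mul_sum]
    _ = ∑ Y ∈ L, ∑ B ∈ A.powerset with Y ≤ B.inf id, (-1 : ℤ[X]) ^ B.card * χ Y :=
      Finset.sum_comm' fun B Y => by simp only [Finset.mem_filter]; tauto
    _ = ∑ Y ∈ L, if Y = V then χ Y else 0 := by
      refine Finset.sum_congr rfl fun Y hY => ?_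
      rw [← Finset.sum_mul, sum_powerset_le_inf, ite_mul, one_mul, zero_mul]
      exact if_congr (hnotLe Y hY) rfl rfl
    _ = charPoly V A := by
      rw [Finset.sum_ite_eq', if_pos (self_mem_interLattice A hV)]
      exact charPoly_restriction_self hV hVA

theorem charPoly_top_eq_sum (A : Finset (AffineSubspace F (ι → F))) :
    charPoly ⊤ A = ∑ B ∈ A.powerset, (-1 : ℤ[X]) ^ B.card * dimMonomial (B.inf id) := by
  rw [charPoly_eq_sum_powerset (AffineSubspace.bot_ne_top F (ι → F) (ι → F)).symm
    fun H _ => top_le_iff.1]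
  simp only [top_inf_eq]

theorem charPoly_top_insert [DecidableEq (AffineSubspace F (ι → F))]
    (A : Finset (AffineSubspace F (ι → F))) (H : AffineSubspace F (ι → F)) :
    charPoly ⊤ (insert H A) = ∑ B ∈ A.powerset,
      (-1 : ℤ[X]) ^ B.card * (dimMonomial (B.inf id) - dimMonomial (B.inf id ⊓ H)) := by
  rw [charPoly_top_eq_sum]
  simp only [mul_sub, Finset.sum_sub_distrib]
  by_cases hH : H ∈ A
  · rw [sum_powerset_inf_eq_zero hH, sub_zero, Finset.insert_eq_of_mem hH]
  · rw [Finset.sum_powerset_insert hH, sub_eq_add_neg, ← Finset.sum_neg_distrib]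
    congr 1
    refine Finset.sum_congr rfl fun B hB => ?_
    have hHB : H ∉ B := fun h => hH (Finset.mem_powerset.1 hB h)
    rw [Finset.card_insert_of_notMem hHB, Finset.inf_insert, id, inf_comm]
    ring

end CharPoly

section Essential

variable {F : Type*} [Field F] {ι : Type*} {A : Finset (AffineSubspace F (ι → F))}
  {V Z H : AffineSubspace F (ι → F)} {W : Submodule F (ι → F)}

theorem add_mem_iff_mem_direction {z u : ι → F} (hz : z ∈ Z) : u + z ∈ Z ↔ u ∈ Z.direction :=
  AffineSubspace.vadd_mem_iff_mem_direction u hz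

theorem toAffineSubspace_ne_bot (W : Submodule F (ι → F)) : W.toAffineSubspace ≠ ⊥ :=
  ne_bot_of_mem (Submodule.mem_toAffineSubspace.2 (zero_mem W))

theorem toAffineSubspace_inf (W W' : Submodule F (ι → F)) :
    (W ⊓ W').toAffineSubspace = W.toAffineSubspace ⊓ W'.toAffineSubspace := by
  ext x
  simp only [Submodule.mem_toAffineSubspace, AffineSubspace.mem_inf_iff, Submodule.mem_inf]

theorem direction_mem_interLattice_linearization (hZ : Z ∈ interLattice ⊤ A) :
    Z.direction.toAffineSubspace ∈ interLattice ⊤ (linearization A) := by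
  classical
  obtain ⟨hne, -, hZ⟩ := mem_interLattice_iff.1 hZ
  obtain ⟨z, hz⟩ := (AffineSubspace.nonempty_iff_ne_bot Z).2 hne
  refine mem_interLattice_iff.2 ⟨toAffineSubspace_ne_bot _, le_top, fun u _ hu => ?_⟩
  refine (add_mem_iff_mem_direction hz).1 (hZ _ trivial fun H hH hZH => ?_)
  exact (add_mem_iff_mem_direction (hZH hz)).2 (hu _ (Finset.mem_image_of_mem _ hH)
    fun _ hv => AffineSubspace.direction_le hZH hv)

theorem inf_direction_mem_interLattice_linearization
    (hW : W.toAffineSubspace ∈ interLattice ⊤ (linearization A)) (hH : H ∈ A) :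
    (W ⊓ H.direction).toAffineSubspace ∈ interLattice ⊤ (linearization A) := by
  classical
  have hne := toAffineSubspace_ne_bot (W ⊓ H.direction)
  rw [toAffineSubspace_inf] at hne ⊢
  exact inf_mem_interLattice hW (Finset.mem_image_of_mem _ hH) hne

/-- The lines in direction `u` all meet `H`, each in a single point. -/
def IsTransverse (u : ι → F) (H : AffineSubspace F (ι → F)) : Prop :=
  u ∉ H.direction ∧ ∀ z : ι → F, ∃ c : F, c • u + z ∈ H

theorem IsTransverse.le_inf_direction_sup_span {u : ι → F} (hu : IsTransverse u H) (huW : u ∈ W) :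
    W ≤ W ⊓ H.direction ⊔ Submodule.span F {u} := by
  intro w hw
  obtain ⟨c₀, hz⟩ := hu.2 0
  obtain ⟨c, hc⟩ := hu.2 (w + (c₀ • u + 0))
  rw [← add_assoc, add_mem_iff_mem_direction hz] at hc
  refine Submodule.mem_sup.2 ⟨c • u + w, ⟨W.add_mem (W.smul_mem c huW) hw, hc⟩, -c • u,
    Submodule.smul_mem _ _ (Submodule.mem_span_singleton_self u), ?_⟩
  rw [neg_smul, add_neg_eq_iff_eq_add, add_comm]

theorem IsTransverse.inf_direction_lt {u : ι → F} (hu : IsTransverse u H) (huW : u ∈ W) :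
    W ⊓ H.direction < W :=
  inf_le_left.lt_of_ne fun h => hu.1 (h.ge huW).2

variable [Fintype ι]

theorem mem_hyperplane {α x : ι → F} {a : F} : x ∈ hyperplane α a ↔ α ⬝ᵥ x = a :=
  Iff.rfl

theorem exists_smul_add_mem_hyperplane {α u : ι → F} (hu : α ⬝ᵥ u ≠ 0) (a : F) (z : ι → F) :
    ∃ c : F, c • u + z ∈ hyperplane α a := by
  refine ⟨(a - α ⬝ᵥ z) / (α ⬝ᵥ u), ?_⟩
  rw [mem_hyperplane, dotProduct_add, dotProduct_smul, smul_eq_mul, div_mul_cancel₀ _ hu,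
    sub_add_cancel]

theorem mem_direction_hyperplane {α z x : ι → F} {a : F} (hz : z ∈ hyperplane α a) :
    x ∈ (hyperplane α a).direction ↔ α ⬝ᵥ x = 0 := by
  rw [← add_mem_iff_mem_direction hz, mem_hyperplane, dotProduct_add, mem_hyperplane.1 hz,
    add_eq_right]

theorem isTransverse_hyperplane {α u : ι → F} (hu : α ⬝ᵥ u ≠ 0) (a : F) :
    IsTransverse u (hyperplane α a) := by
  refine ⟨fun h => hu ?_, exists_smul_add_mem_hyperplane hu a⟩
  obtain ⟨c, hc⟩ := exists_smul_add_mem_hyperplane hu a 0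
  exact (mem_direction_hyperplane hc).1 h

theorem IsEssential.exists_isTransverse (hA : IsEssential A) {u : ι → F} (hu : u ≠ 0) :
    ∃ H ∈ A, IsTransverse u H := by
  classical
  by_contra! h
  refine hu (dotProduct_eq_zero u fun β => ?_)
  suffices hker : Submodule.span F {α : ι → F | ∃ a : F, hyperplane α a ∈ A} ≤
      LinearMap.ker (dotProductEquiv F ι u) by
    exact hker (hA ▸ Submodule.mem_top)
  refine Submodule.span_le.2 ?_
  rintro α ⟨a, hH⟩
  by_contra hα
  exact h _ hH (isTransverse_hyperplane (dotProduct_comm α u ▸ hα) a)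

theorem IsEssential.exists_vertex (hA : IsEssential A) (hZ : Z ∈ interLattice V A) :
    ∃ v ∈ Z, AffineSubspace.mk' v ⊥ ∈ interLattice V A := by
  induction hn : Module.finrank F Z.direction using Nat.strong_induction_on generalizing Z with
  | _ n ih =>
  obtain ⟨z, hz⟩ := (AffineSubspace.nonempty_iff_ne_bot Z).2 (mem_interLattice_iff.1 hZ).1
  by_cases hdir : Z.direction = ⊥
  · exact ⟨z, hz, by rwa [← hdir, AffineSubspace.mk'_eq hz]⟩
  obtain ⟨u, huZ, hu⟩ := (Submodule.ne_bot_iff _).1 hdir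
  obtain ⟨H, hH, huH⟩ := hA.exists_isTransverse hu
  obtain ⟨c, hc⟩ := huH.2 z
  have hmem : c • u + z ∈ Z ⊓ H := (AffineSubspace.mem_inf_iff _ _ _).2
    ⟨(add_mem_iff_mem_direction hz).2 (Submodule.smul_mem _ _ huZ), hc⟩
  have hlt : (Z ⊓ H).direction < Z.direction := by
    rw [AffineSubspace.direction_inf_of_mem_inf hmem]
    exact huH.inf_direction_lt huZ
  obtain ⟨v, hv, hvL⟩ := ih _ (hn ▸ Submodule.finrank_lt_finrank_of_lt hlt)
    (inf_mem_interLattice hZ hH (ne_bot_of_mem hmem)) rfl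
  exact ⟨v, hv.1, hvL⟩

/-- The nonzero vectors spanning a line of `L(A°)`. -/
def lineDirections (A : Finset (AffineSubspace F (ι → F))) : Set (ι → F) :=
  {u | u ≠ 0 ∧ (Submodule.span F {u}).toAffineSubspace ∈ interLattice ⊤ (linearization A)}

theorem IsEssential.le_span_lineDirections (hA : IsEssential A)
    (hW : W.toAffineSubspace ∈ interLattice ⊤ (linearization A)) :
    W ≤ Submodule.span F (W ∩ lineDirections A) := by
  induction hn : Module.finrank F W using Nat.strong_induction_on generalizing W with
  | _ n ih =>
  by_cases hbot : W = ⊥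
  · exact hbot ▸ bot_le
  have hcut : ∀ u ∈ W, ∀ H ∈ A, IsTransverse u H →
      W ⊓ H.direction ≤ Submodule.span F (W ∩ lineDirections A) := fun u huW H hH huH =>
    (ih _ (hn ▸ Submodule.finrank_lt_finrank_of_lt (huH.inf_direction_lt huW))
      (inf_direction_mem_interLattice_linearization hW hH) rfl).trans
      (Submodule.span_mono (Set.inter_subset_inter_left _ inf_le_left))
  obtain ⟨u, huW, hu⟩ := (Submodule.ne_bot_iff _).1 hbot
  obtain ⟨H, hH, huH⟩ := hA.exists_isTransverse hu
  by_cases hline : W ⊓ H.direction = ⊥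
  · have hspan : W = Submodule.span F {u} := by
      refine le_antisymm ?_ (by simpa using huW)
      simpa [hline] using huH.le_inf_direction_sup_span huW
    rw [hspan] at hW
    exact hspan.le.trans (Submodule.span_mono (Set.singleton_subset_iff.2 ⟨huW, hu, hW⟩))
  · obtain ⟨u', hu'W, hu'⟩ := (Submodule.ne_bot_iff _).1 hline
    obtain ⟨H', hH', hu'H'⟩ := hA.exists_isTransverse hu'
    refine (hu'H'.le_inf_direction_sup_span hu'W.1).trans (sup_le (hcut u' hu'W.1 H' hH' hu'H') ?_)
    exact (Submodule.span_singleton_le_iff_mem _ _).2 (hcut u huW H hH huH hu'W)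

end Essential

section Adjoint

variable {F : Type*} [Field F] {d : ℕ} {A : Finset (AffineSubspace F (Fin d → F))}
  {Z : AffineSubspace F (Fin d → F)} {W : Submodule F (Fin d → F)} {P : Fin (d + 1) → F}

/-- The normal vector `α` of the hyperplane encoded by `P = (α, a)`. -/
def normal (P : Fin (d + 1) → F) : Fin d → F :=
  fun i => P i.castSucc

theorem normal_pair {R : Type*} (v : Fin d → R) (c : R) : normal (pair v c) = v :=
  Fin.init_snoc (α := fun _ => R) c v

theorem pair_last {R : Type*} (v : Fin d → R) (c : R) : pair v c (Fin.last d) = c :=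
  Fin.snoc_last (α := fun _ => R) c v

theorem pair_dotProduct (v : Fin d → F) (c : F) (P : Fin (d + 1) → F) :
    pair v c ⬝ᵥ P = normal P ⬝ᵥ v + c * P (Fin.last d) := by
  simp [pair, normal, dotProduct, Fin.sum_univ_castSucc, mul_comm]

theorem mem_hyperplane_pair_zero {u : Fin d → F} :
    P ∈ hyperplane (pair u 0) 0 ↔ normal P ⬝ᵥ u = 0 := by
  rw [mem_hyperplane, pair_dotProduct, zero_mul, add_zero]

/-- The hyperplane `H_{α,a}` encoded by `P = (α, a)`. -/
def dualHyperplane (P : Fin (d + 1) → F) : AffineSubspace F (Fin d → F) :=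
  hyperplane (normal P) (P (Fin.last d))

theorem mem_hyperplane_pair_neg_one {v : Fin d → F} :
    P ∈ hyperplane (pair v (-1)) 0 ↔ v ∈ dualHyperplane P := by
  rw [mem_hyperplane, pair_dotProduct, neg_one_mul, add_neg_eq_zero, dualHyperplane, mem_hyperplane]

/-- The space of all `(α, a)` such that `α` vanishes on `W`, that is, such that every
`H_{α,a}` with `α ≠ 0` is parallel to `W`. -/
def parallelSpace (W : Submodule F (Fin d → F)) : Submodule F (Fin (d + 1) → F) :=
  LinearMap.ker (W.subtype.dualMap ∘ₗ (dotProductEquiv F (Fin d)).toLinearMap ∘ₗ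
    LinearMap.funLeft F F Fin.castSucc)

/-- The space of all `(α, a)` such that `Z` is contained in `H_{α,a}`. -/
def containingSpace (Z : AffineSubspace F (Fin d → F)) : Submodule F (Fin (d + 1) → F) :=
  ⨅ z ∈ Z, LinearMap.ker (dotProductEquiv F (Fin (d + 1)) (pair z (-1)))

theorem mem_parallelSpace : P ∈ parallelSpace W ↔ ∀ u ∈ W, normal P ⬝ᵥ u = 0 := by
  rw [parallelSpace, LinearMap.mem_ker, LinearMap.ext_iff, Subtype.forall]
  rfl

theorem mem_parallelSpace_iff_le_ker :
    P ∈ parallelSpace W ↔ W ≤ LinearMap.ker (dotProductEquiv F (Fin d) (normal P)) :=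
  mem_parallelSpace

theorem mem_containingSpace : P ∈ containingSpace Z ↔ Z ≤ dualHyperplane P := by
  simp only [containingSpace, Submodule.mem_iInf]
  exact forall₂_congr fun z _ => mem_hyperplane_pair_neg_one

theorem mem_containingSpace_iff_of_mem {v : Fin d → F} (hv : v ∈ Z) :
    P ∈ containingSpace Z ↔ P ∈ parallelSpace Z.direction ∧ v ∈ dualHyperplane P := by
  rw [mem_containingSpace, mem_parallelSpace]
  constructor
  · exact fun h => ⟨fun u hu => (mem_direction_hyperplane (h hv)).1
      (AffineSubspace.direction_le h hu), h hv⟩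
  · rintro ⟨hpar, hvP⟩ z hz
    have hdir := AffineSubspace.vsub_mem_direction hz hv
    rw [← sub_add_cancel z v]
    exact (add_mem_iff_mem_direction hvP).2 ((mem_direction_hyperplane hvP).2 (hpar _ hdir))

theorem toAffineSubspace_containingSpace {v : Fin d → F} (hv : v ∈ Z) :
    (containingSpace Z).toAffineSubspace =
      (parallelSpace Z.direction).toAffineSubspace ⊓ hyperplane (pair v (-1)) 0 := by
  ext P
  rw [AffineSubspace.mem_inf_iff, mem_hyperplane_pair_neg_one]
  exact mem_containingSpace_iff_of_mem hv

theorem finrank_parallelSpace (W : Submodule F (Fin d → F)) :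
    Module.finrank F (parallelSpace W) + Module.finrank F W = d + 1 := by
  have hsurj : Function.Surjective (W.subtype.dualMap ∘ₗ
      (dotProductEquiv F (Fin d)).toLinearMap ∘ₗ LinearMap.funLeft F F Fin.castSucc) := by
    exact (LinearMap.dualMap_surjective_of_injective W.injective_subtype).comp
      ((dotProductEquiv F (Fin d)).surjective.comp
        (LinearMap.funLeft_surjective_of_injective F F _ (Fin.castSucc_injective d)))
  have h := LinearMap.finrank_range_add_finrank_ker (W.subtype.dualMap ∘ₗ
    (dotProductEquiv F (Fin d)).toLinearMap ∘ₗ LinearMap.funLeft F F Fin.castSucc)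
  rwa [LinearMap.range_eq_top.2 hsurj, finrank_top, Subspace.dual_finrank_eq,
    Module.finrank_fin_fun, add_comm] at h

theorem finrank_inf_ker_add_one {V : Type*} [AddCommGroup V] [Module F V] [FiniteDimensional F V]
    {U : Submodule F V} {f : V →ₗ[F] F} {u : V} (hu : u ∈ U) (hf : f u ≠ 0) :
    Module.finrank F (U ⊓ LinearMap.ker f : Submodule F V) + 1 = Module.finrank F U := by
  have hsurj : Function.Surjective (f.domRestrict U) :=
    LinearMap.surjective fun h0 => hf (LinearMap.congr_fun h0 ⟨u, hu⟩)
  have h := LinearMap.finrank_range_add_finrank_ker (f.domRestrict U)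
  have hker : Submodule.map U.subtype (LinearMap.ker (f.domRestrict U)) = U ⊓ LinearMap.ker f := by
    ext x
    simp [and_comm]
  rwa [LinearMap.range_eq_top.2 hsurj, finrank_top, Module.finrank_self, add_comm,
    ← Submodule.finrank_map_subtype_eq, hker] at h

theorem finrank_containingSpace (hZ : Z ≠ ⊥) :
    Module.finrank F (containingSpace Z) + Module.finrank F Z.direction = d := by
  obtain ⟨v, hv⟩ := (AffineSubspace.nonempty_iff_ne_bot Z).2 hZ
  have hmem : pair 0 1 ∈ parallelSpace Z.direction := by
    simp [mem_parallelSpace, normal_pair]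
  have hne : dotProductEquiv F (Fin (d + 1)) (pair v (-1)) (pair 0 1) ≠ 0 := by
    simp [pair_dotProduct, normal_pair, pair_last]
  have hinf : containingSpace Z = parallelSpace Z.direction ⊓
      LinearMap.ker (dotProductEquiv F (Fin (d + 1)) (pair v (-1))) :=
    SetLike.ext fun P => SetLike.ext_iff.1 (toAffineSubspace_containingSpace hv) P
  have hcut := finrank_inf_ker_add_one hmem hne
  rw [← hinf] at hcut
  have hpar := finrank_parallelSpace Z.direction
  lia

theorem hyperplane_pair_neg_one_mem_adjoint {v : Fin d → F}
    (hv : AffineSubspace.mk' v ⊥ ∈ interLattice ⊤ A) : hyperplane (pair v (-1)) 0 ∈ adjoint A :=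
  (Set.Finite.mem_toFinset _).2 (Or.inl ⟨v, hv, rfl⟩)

theorem hyperplane_pair_zero_mem_adjoint {u : Fin d → F} (hu : u ∈ lineDirections A) :
    hyperplane (pair u 0) 0 ∈ adjoint A :=
  (Set.Finite.mem_toFinset _).2 (Or.inr ⟨u, hu.1, hu.2, rfl⟩)

theorem IsEssential.parallelSpace_mem_interLattice_adjoint (hA : IsEssential A)
    (hW : W.toAffineSubspace ∈ interLattice ⊤ (linearization A)) :
    (parallelSpace W).toAffineSubspace ∈ interLattice ⊤ (adjoint A) := by
  refine mem_interLattice_iff.2 ⟨toAffineSubspace_ne_bot _, le_top, fun P _ hP => ?_⟩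
  refine mem_parallelSpace_iff_le_ker.2
    ((hA.le_span_lineDirections hW).trans (Submodule.span_le.2 ?_))
  rintro u ⟨huW, hu⟩
  refine mem_hyperplane_pair_zero.1 (hP _ (hyperplane_pair_zero_mem_adjoint hu) fun Q hQ => ?_)
  exact mem_hyperplane_pair_zero.2 (mem_parallelSpace.1 hQ u huW)

theorem IsEssential.containingSpace_mem_interLattice_adjoint (hA : IsEssential A)
    (hZ : Z ∈ interLattice ⊤ A) :
    (containingSpace Z).toAffineSubspace ∈ interLattice ⊤ (adjoint A) := by
  obtain ⟨v, hv, hvA⟩ := hA.exists_vertex hZ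
  have hne := toAffineSubspace_ne_bot (containingSpace Z)
  rw [toAffineSubspace_containingSpace hv] at hne ⊢
  exact inf_mem_interLattice (hA.parallelSpace_mem_interLattice_adjoint
    (direction_mem_interLattice_linearization hZ)) (hyperplane_pair_neg_one_mem_adjoint hvA) hne

end Adjoint

section Strata

variable {F : Type*} [Field F] {d : ℕ} {A : Finset (AffineSubspace F (Fin d → F))}
  {Y : AffineSubspace F (Fin (d + 1) → F)} {Z : AffineSubspace F (Fin d → F)}
  {P : Fin (d + 1) → F}

open Classical in
/-- The value of `t ^ dim Z - t ^ dim (Z ∩ H_{α,a})` at a generic point `(α, a)` of `S`. If `Z` is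
a point, then `parallelSpace Z.direction = ⊤`, so that the two terms with the truncated exponent
`dim Z - 1` cancel. -/
noncomputable def cutPoly (Z : AffineSubspace F (Fin d → F)) (S : Set (Fin (d + 1) → F)) : ℤ[X] :=
  if Z = ⊥ then 0
  else X ^ Module.finrank F Z.direction - X ^ (Module.finrank F Z.direction - 1) +
    (if S ⊆ parallelSpace Z.direction then X ^ (Module.finrank F Z.direction - 1) else 0) -
    (if S ⊆ containingSpace Z then X ^ Module.finrank F Z.direction else 0)

theorem cutPoly_bot (S : Set (Fin (d + 1) → F)) : cutPoly ⊥ S = 0 :=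
  if_pos rfl

theorem cutPoly_congr {K : Type*} [Field K] {Z' : AffineSubspace K (Fin d → K)}
    {S : Set (Fin (d + 1) → F)} {S' : Set (Fin (d + 1) → K)} (hbot : Z = ⊥ ↔ Z' = ⊥)
    (hpar : S ⊆ parallelSpace Z.direction ↔ S' ⊆ parallelSpace Z'.direction)
    (hcon : S ⊆ containingSpace Z ↔ S' ⊆ containingSpace Z')
    (hdim : Module.finrank F Z.direction = Module.finrank K Z'.direction) :
    cutPoly Z S = cutPoly Z' S' := by
  classical
  rw [cutPoly, cutPoly, hdim]
  exact if_congr hbot rfl (congrArg₂ (· - ·) (congrArg _ (if_congr hpar rfl rfl))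
    (if_congr hcon rfl rfl))

theorem dimMonomial_inf_dualHyperplane (hZ : Z ≠ ⊥) (hP : P ∉ parallelSpace Z.direction) :
    dimMonomial (Z ⊓ dualHyperplane P) = X ^ (Module.finrank F Z.direction - 1) := by
  rw [mem_parallelSpace] at hP
  push Not at hP
  obtain ⟨u, huZ, hu⟩ := hP
  obtain ⟨v, hv⟩ := (AffineSubspace.nonempty_iff_ne_bot Z).2 hZ
  obtain ⟨c, hc⟩ := exists_smul_add_mem_hyperplane hu (P (Fin.last d)) v
  have hmem : c • u + v ∈ Z ⊓ dualHyperplane P :=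
    ⟨(add_mem_iff_mem_direction hv).2 (Submodule.smul_mem _ _ huZ), hc⟩
  have hdir : (Z ⊓ dualHyperplane P).direction =
      Z.direction ⊓ LinearMap.ker (dotProductEquiv F (Fin d) (normal P)) := by
    rw [AffineSubspace.direction_inf_of_mem_inf hmem]
    ext x
    exact and_congr_right' (mem_direction_hyperplane hc)
  rw [dimMonomial_of_ne_bot (ne_bot_of_mem hmem), hdir,
    ← finrank_inf_ker_add_one (f := dotProductEquiv F (Fin d) (normal P)) huZ hu,
    Nat.add_sub_cancel]

theorem dimMonomial_sub_dimMonomial_inf (Z : AffineSubspace F (Fin d → F))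
    (P : Fin (d + 1) → F) :
    dimMonomial Z - dimMonomial (Z ⊓ dualHyperplane P) = cutPoly Z {P} := by
  by_cases hZ : Z = ⊥
  · rw [hZ, cutPoly_bot, bot_inf_eq, sub_self]
  obtain ⟨v, hv⟩ := (AffineSubspace.nonempty_iff_ne_bot Z).2 hZ
  rw [cutPoly, if_neg hZ, Set.singleton_subset_iff, Set.singleton_subset_iff, SetLike.mem_coe,
    SetLike.mem_coe, dimMonomial_of_ne_bot hZ]
  by_cases hpar : P ∈ parallelSpace Z.direction
  · by_cases hcon : P ∈ containingSpace Z
    · rw [inf_eq_left.2 (mem_containingSpace.1 hcon), dimMonomial_of_ne_bot hZ, if_pos hpar,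
        if_pos hcon]
      ring
    · have hdisj : Z ⊓ dualHyperplane P = ⊥ := by
        by_contra hne
        obtain ⟨z, hz⟩ := (AffineSubspace.nonempty_iff_ne_bot _).2 hne
        exact hcon ((mem_containingSpace_iff_of_mem hz.1).2 ⟨hpar, hz.2⟩)
      rw [hdisj, dimMonomial_bot, if_pos hpar, if_neg hcon]
      ring
  · have hcon : P ∉ containingSpace Z := fun h =>
      hpar ((mem_containingSpace_iff_of_mem hv).1 h).1
    rw [dimMonomial_inf_dualHyperplane hZ hpar, if_neg hpar, if_neg hcon]
    ring

theorem IsEssential.cutPoly_singleton_of_mem_stratum (hA : IsEssential A)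
    (hZ : Z ∈ interLattice ⊤ A) (hP : P ∈ stratum A Y) : cutPoly Z {P} = cutPoly Z Y := by
  have hE := hA.parallelSpace_mem_interLattice_adjoint
    (direction_mem_interLattice_linearization hZ)
  have hC := hA.containingSpace_mem_interLattice_adjoint hZ
  exact cutPoly_congr Iff.rfl
    (Set.singleton_subset_iff.trans (mem_iff_le_of_mem_complement_restriction hE le_top hP))
    (Set.singleton_subset_iff.trans (mem_iff_le_of_mem_complement_restriction hC le_top hP)) rfl

/-- The characteristic polynomial `χ(Y, t)` of the one-element extensions in the stratum of `Y`. -/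
noncomputable def strataPoly (A : Finset (AffineSubspace F (Fin d → F)))
    (Y : AffineSubspace F (Fin (d + 1) → F)) : ℤ[X] :=
  ∑ B ∈ A.powerset, (-1 : ℤ[X]) ^ B.card * cutPoly (B.inf id) Y

theorem finset_inf_mem_interLattice_top {B : Finset (AffineSubspace F (Fin d → F))} (hB : B ⊆ A)
    (hne : B.inf id ≠ ⊥) : B.inf id ∈ interLattice ⊤ A := by
  rw [← top_inf_eq (B.inf id)] at hne ⊢
  exact inf_finset_inf_mem_interLattice hB hne

theorem IsEssential.isCommonCharPoly_strataPoly (hA : IsEssential A)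
    (Y : AffineSubspace F (Fin (d + 1) → F)) : IsCommonCharPoly A Y (strataPoly A Y) := by
  classical
  intro P hP
  rw [oneExt, charPoly_top_insert, strataPoly]
  refine Finset.sum_congr rfl fun B hB => congrArg _ ?_
  refine (dimMonomial_sub_dimMonomial_inf _ P).trans ?_
  by_cases hbot : B.inf id = ⊥
  · rw [hbot, cutPoly_bot, cutPoly_bot]
  · exact hA.cutPoly_singleton_of_mem_stratum
      (finset_inf_mem_interLattice_top (Finset.mem_powerset.1 hB) hbot) hP

open Classical in
theorem sum_charPoly_restriction_mul_ite {ι : Type*} {A : Finset (AffineSubspace F (ι → F))}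
    {V E : AffineSubspace F (ι → F)} (hE : E ∈ interLattice V A) (p : ℤ[X]) :
    ∑ Y ∈ interLattice V A, charPoly Y (restriction A Y) * (if Y ≤ E then p else 0) =
      dimMonomial E * p := by
  simp only [mul_ite, mul_zero]
  rw [← Finset.sum_filter, ← Finset.sum_mul, sum_charPoly_restriction hE]

theorem pow_mul_pow_cut {R : Type*} [CommRing R] (x : R) {d k e c : ℕ} (he : e + k = d + 1)
    (hc : c + k = d) :
    x ^ (d + 1) * (x ^ k - x ^ (k - 1)) + x ^ e * x ^ (k - 1) - x ^ c * x ^ k =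
      x ^ d * (x - 1) * x ^ k := by
  obtain rfl : e = c + 1 := by lia
  subst hc
  cases k with
  | zero => simp; ring
  | succ k => rw [Nat.add_sub_cancel]; ring

open Classical in
theorem cutPoly_eq_sum_ite (hZ : Z ≠ ⊥) (Y : AffineSubspace F (Fin (d + 1) → F)) :
    cutPoly Z Y =
      (if Y ≤ ⊤ then
        X ^ Module.finrank F Z.direction - X ^ (Module.finrank F Z.direction - 1) else 0) +
      (if Y ≤ (parallelSpace Z.direction).toAffineSubspace then
        X ^ (Module.finrank F Z.direction - 1) else 0) -
      (if Y ≤ (containingSpace Z).toAffineSubspace then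
        X ^ Module.finrank F Z.direction else 0) := by
  rw [cutPoly, if_neg hZ, if_pos le_top]
  rfl

theorem IsEssential.sum_charPoly_mul_cutPoly (hA : IsEssential A) (hZ : Z ∈ interLattice ⊤ A) :
    ∑ Y ∈ interLattice ⊤ (adjoint A), charPoly Y (restriction (adjoint A) Y) * cutPoly Z Y =
      X ^ d * (X - 1) * dimMonomial Z := by
  have hZne := (mem_interLattice_iff.1 hZ).1
  have htop : (⊤ : AffineSubspace F (Fin (d + 1) → F)) ∈ interLattice ⊤ (adjoint A) :=
    self_mem_interLattice _ (AffineSubspace.bot_ne_top F _ _).symm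
  have hpar := hA.parallelSpace_mem_interLattice_adjoint
    (direction_mem_interLattice_linearization hZ)
  have hcon := hA.containingSpace_mem_interLattice_adjoint hZ
  simp only [cutPoly_eq_sum_ite hZne, mul_add, mul_sub, Finset.sum_add_distrib,
    Finset.sum_sub_distrib]
  rw [sum_charPoly_restriction_mul_ite htop, sum_charPoly_restriction_mul_ite hpar,
    sum_charPoly_restriction_mul_ite hcon, dimMonomial_of_ne_bot (mem_interLattice_iff.1 htop).1,
    dimMonomial_of_ne_bot (toAffineSubspace_ne_bot _),
    dimMonomial_of_ne_bot (toAffineSubspace_ne_bot _), dimMonomial_of_ne_bot hZne,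
    Submodule.toAffineSubspace_direction, Submodule.toAffineSubspace_direction,
    AffineSubspace.direction_top, finrank_top, Module.finrank_fin_fun]
  linear_combination pow_mul_pow_cut (X : ℤ[X]) (finrank_parallelSpace Z.direction)
    (finrank_containingSpace hZne)

theorem IsEssential.sum_charPoly_mul_strataPoly (hA : IsEssential A) :
    ∑ Y ∈ interLattice ⊤ (adjoint A), charPoly Y (restriction (adjoint A) Y) * strataPoly A Y =
      X ^ d * (X - 1) * charPoly ⊤ A := by
  simp only [strataPoly, Finset.mul_sum, charPoly_top_eq_sum A]
  rw [Finset.sum_comm]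
  refine Finset.sum_congr rfl fun B hB => ?_
  simp only [mul_left_comm _ ((-1 : ℤ[X]) ^ B.card)]
  rw [← Finset.mul_sum]
  refine congrArg _ ?_
  by_cases hbot : B.inf id = ⊥
  · simp only [hbot, cutPoly_bot, dimMonomial_bot, mul_zero, Finset.sum_const_zero]
  · exact hA.sum_charPoly_mul_cutPoly
      (finset_inf_mem_interLattice_top (Finset.mem_powerset.1 hB) hbot)

end Strata

section BaseChange

variable {F : Type*} [Field F] {ι : Type*} (K : Type*) [Field K] [Algebra F K]
  {W : Submodule F (ι → F)} {Y Z : AffineSubspace F (ι → F)}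

/-- The inclusion `F^ι → K^ι` for a field extension `K / F`. -/
def liftVec : (ι → F) →ₗ[F] (ι → K) :=
  (Algebra.linearMap F K).compLeft ι

theorem liftVec_mem_baseChange {z : ι → F} (hz : z ∈ Z) : liftVec K z ∈ baseChange K Z :=
  mem_affineSpan K ⟨z, hz, rfl⟩

theorem baseChange_le_iff {T : AffineSubspace K (ι → K)} :
    baseChange K Z ≤ T ↔ ∀ z ∈ Z, liftVec K z ∈ T := by
  rw [baseChange, affineSpan_le, Set.image_subset_iff]
  rfl

theorem baseChange_eq_bot_iff : baseChange K Z = ⊥ ↔ Z = ⊥ := by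
  rw [baseChange, affineSpan_eq_bot, Set.image_eq_empty, AffineSubspace.coe_eq_bot_iff]

theorem direction_baseChange (hZ : Z ≠ ⊥) :
    (baseChange K Z).direction = Submodule.span K (liftVec K '' (Z.direction : Set (ι → F))) := by
  obtain ⟨z, hz⟩ := (AffineSubspace.nonempty_iff_ne_bot Z).2 hZ
  apply le_antisymm
  · rw [baseChange, direction_affineSpan, vectorSpan_def, Submodule.span_le]
    rintro _ ⟨_, ⟨x, hx, rfl⟩, _, ⟨y, hy, rfl⟩, rfl⟩
    exact Submodule.subset_span
      ⟨x - y, AffineSubspace.vsub_mem_direction hx hy, map_sub (liftVec K) x y⟩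
  · rw [Submodule.span_le]
    rintro _ ⟨u, hu, rfl⟩
    rw [SetLike.mem_coe, ← add_mem_iff_mem_direction (liftVec_mem_baseChange K hz), ← map_add]
    exact liftVec_mem_baseChange K ((add_mem_iff_mem_direction hz).2 hu)

theorem span_liftVec_image_span (S : Set (ι → F)) :
    Submodule.span K (liftVec K '' (Submodule.span F S : Set (ι → F))) =
      Submodule.span K (liftVec K '' S) := by
  rw [← Submodule.map_coe, Submodule.map_span, Submodule.span_span_of_tower]

theorem finrank_span_liftVec [Finite ι] (W : Submodule F (ι → F)) :
    Module.finrank K (Submodule.span K (liftVec K '' (W : Set (ι → F)))) = Module.finrank F W := by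
  let b := Module.finBasis F W
  have hli : LinearIndependent F fun i => (b i : ι → F) :=
    b.linearIndependent.map' W.subtype W.ker_subtype
  have hspan : Submodule.span F (Set.range fun i => (b i : ι → F)) = W := by
    have h := congrArg (Submodule.map W.subtype) b.span_eq
    rwa [Submodule.map_span, ← Set.range_comp, Submodule.map_subtype_top] at h
  have hliK : LinearIndependent K fun i => liftVec K (b i : ι → F) :=
    linearIndependent_algebraMap_comp_iff.2 hli
  rw [← hspan, span_liftVec_image_span, ← Set.range_comp]
  exact (finrank_span_eq_card hliK).trans (finrank_span_eq_card hli).symm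

variable {K}

/-- The vector in `F^ι` obtained by applying a functional `f : K → F` to every coordinate. -/
def applyCoords (f : K →ₗ[F] F) : (ι → K) →ₗ[F] (ι → F) :=
  f.compLeft ι

theorem applyCoords_smul_liftVec (f : K →ₗ[F] F) (c : K) (x : ι → F) :
    applyCoords f (c • liftVec K x) = f c • x := by
  funext i
  simp [applyCoords, liftVec, mul_comm c, ← Algebra.smul_def, mul_comm (x i)]

theorem eq_sum_basis_smul_liftVec [Finite ι] {κ : Type*} (b : Module.Basis κ F K) (y : ι → K) :
    ∃ s : Finset κ, y = ∑ j ∈ s, b j • liftVec K (applyCoords (b.coord j) y) := by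
  classical
  have := Fintype.ofFinite ι
  refine ⟨Finset.univ.biUnion fun i => (b.repr (y i)).support, funext fun i => ?_⟩
  have hsupp := Finset.subset_biUnion_of_mem (fun i => (b.repr (y i)).support) (Finset.mem_univ i)
  calc y i = (b.repr (y i)).sum fun j c => c • b j := (b.linearCombination_repr (y i)).symm
    _ = _ := Finsupp.sum_of_support_subset _ hsupp _ fun _ _ => zero_smul F _
    _ = _ := by
      rw [Finset.sum_apply]
      refine Finset.sum_congr rfl fun j _ => ?_
      rw [Algebra.smul_def, mul_comm]
      rfl

theorem mem_span_liftVec_iff [Finite ι] {y : ι → K} :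
    y ∈ Submodule.span K (liftVec K '' (W : Set (ι → F))) ↔
      ∀ f : K →ₗ[F] F, applyCoords f y ∈ W := by
  constructor
  · intro hy
    induction hy using Submodule.span_induction with
    | mem y hy =>
      obtain ⟨x, hx, rfl⟩ := hy
      intro f
      rw [← one_smul K (liftVec K x), applyCoords_smul_liftVec]
      exact Submodule.smul_mem _ _ hx
    | zero =>
      intro f
      rw [map_zero]
      exact zero_mem W
    | add _ _ _ _ hx hy => exact fun f => map_add (applyCoords f) _ _ ▸ add_mem (hx f) (hy f)
    | smul c _ _ hx => exact fun f => hx (f ∘ₗ LinearMap.mulLeft F c)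
  · intro hy
    obtain ⟨s, hs⟩ := eq_sum_basis_smul_liftVec (Module.Basis.ofVectorSpace F K) y
    rw [hs]
    exact Submodule.sum_mem _ fun j _ => Submodule.smul_mem _ _
      (Submodule.subset_span ⟨_, hy _, rfl⟩)

theorem exists_apply_one_eq_one : ∃ f : K →ₗ[F] F, f 1 = 1 := by
  obtain ⟨f, hf⟩ := LinearMap.exists_leftInverse_of_injective (Algebra.linearMap F K)
    (LinearMap.ker_eq_bot.2 (algebraMap F K).injective)
  exact ⟨f, by simpa using LinearMap.congr_fun hf 1⟩

theorem applyCoords_liftVec {f : K →ₗ[F] F} (hf : f 1 = 1) (x : ι → F) :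
    applyCoords f (liftVec K x) = x := by
  rw [← one_smul K (liftVec K x), applyCoords_smul_liftVec, hf, one_smul]

theorem mem_baseChange_iff [Finite ι] {x : ι → K} :
    x ∈ baseChange K Z ↔ ∀ f : K →ₗ[F] F, f 1 = 1 → applyCoords f x ∈ Z := by
  obtain ⟨f₀, hf₀⟩ := exists_apply_one_eq_one (F := F) (K := K)
  have hbase {p : ι → F} (hp : p ∈ Z) : x ∈ baseChange K Z ↔
      ∀ f : K →ₗ[F] F, applyCoords f x - f 1 • p ∈ Z.direction := by
    rw [← sub_add_cancel x (liftVec K p), add_mem_iff_mem_direction (liftVec_mem_baseChange K hp),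
      direction_baseChange K (ne_bot_of_mem hp), mem_span_liftVec_iff]
    refine forall_congr' fun f => ?_
    rw [sub_add_cancel, map_sub, ← one_smul K (liftVec K p), applyCoords_smul_liftVec]
  constructor
  · intro hx f hf
    obtain ⟨p, hp⟩ := (AffineSubspace.nonempty_iff_ne_bot Z).2
      fun h => ne_bot_of_mem hx ((baseChange_eq_bot_iff K).2 h)
    have hdir := (hbase hp).1 hx f
    rwa [← add_mem_iff_mem_direction hp, hf, one_smul, sub_add_cancel] at hdir
  · intro hx
    have hp := hx f₀ hf₀
    refine (hbase hp).2 fun f => ?_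
    have hmem := hx (f + (1 - f 1) • f₀) (by simp [hf₀])
    have heq : applyCoords (f + (1 - f 1) • f₀) x =
        applyCoords f x - f 1 • applyCoords f₀ x + applyCoords f₀ x := by
      funext i
      simp only [applyCoords, LinearMap.compLeft_apply, Pi.add_apply, Pi.sub_apply, Pi.smul_apply,
        Function.comp_apply, LinearMap.add_apply, LinearMap.smul_apply, smul_eq_mul]
      ring
    rwa [heq, add_mem_iff_mem_direction hp] at hmem

theorem liftVec_mem_baseChange_iff [Finite ι] {x : ι → F} :
    liftVec K x ∈ baseChange K Z ↔ x ∈ Z := by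
  obtain ⟨f, hf⟩ := exists_apply_one_eq_one (F := F) (K := K)
  refine ⟨fun h => ?_, liftVec_mem_baseChange K⟩
  simpa only [applyCoords_liftVec hf] using mem_baseChange_iff.1 h f hf

theorem baseChange_injective [Finite ι] :
    Function.Injective (baseChange K : AffineSubspace F (ι → F) → _) := fun Z Z' h =>
  SetLike.ext fun x => by
    rw [← liftVec_mem_baseChange_iff (K := K), h, liftVec_mem_baseChange_iff]

theorem baseChange_finset_inf [Finite ι] [DecidableEq (AffineSubspace K (ι → K))]
    (B : Finset (AffineSubspace F (ι → F))) :
    baseChange K (B.inf id) = (B.image (baseChange K)).inf id := by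
  ext x
  simp only [mem_finset_inf, Finset.forall_mem_image, mem_baseChange_iff]
  exact ⟨fun h H hH f hf => h f hf H hH, fun h f hf H hH => h hH f hf⟩

variable (K) [Fintype ι]

theorem liftVec_mem_hyperplane_iff {α z : ι → F} {a : F} :
    liftVec K z ∈ hyperplane (liftVec K α) (algebraMap F K a) ↔ z ∈ hyperplane α a := by
  rw [mem_hyperplane, mem_hyperplane, ← (algebraMap F K).injective.eq_iff, dotProduct, dotProduct,
    map_sum]
  simp only [map_mul]
  rfl

theorem apply_liftVec_dotProduct (f : K →ₗ[F] F) (α : ι → F) (x : ι → K) :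
    f (liftVec K α ⬝ᵥ x) = α ⬝ᵥ applyCoords f x := by
  simp [liftVec, applyCoords, dotProduct, ← Algebra.smul_def]

theorem baseChange_hyperplane (α : ι → F) (a : F) :
    baseChange K (hyperplane α a) = hyperplane (liftVec K α) (algebraMap F K a) := by
  refine le_antisymm ((baseChange_le_iff K).2 fun z => (liftVec_mem_hyperplane_iff K).2)
    fun x hx => mem_baseChange_iff.2 fun f hf => ?_
  rw [mem_hyperplane, ← apply_liftVec_dotProduct, mem_hyperplane.1 hx,
    Algebra.algebraMap_eq_smul_one, map_smul, hf, smul_eq_mul, mul_one]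

theorem IsEssential.baseChangeArr {A : Finset (AffineSubspace F (ι → F))} (hA : IsEssential A) :
    IsEssential (baseChangeArr K A) := by
  classical
  have hnormals : Submodule.span K (liftVec K '' {α : ι → F | ∃ a : F, hyperplane α a ∈ A}) ≤
      Submodule.span K {α : ι → K | ∃ a : K, hyperplane α a ∈ HypArr.baseChangeArr K A} := by
    refine Submodule.span_mono ?_
    rintro _ ⟨α, ⟨a, ha⟩, rfl⟩
    exact ⟨algebraMap F K a, Finset.mem_image.2 ⟨_, ha, baseChange_hyperplane K α a⟩⟩
  rw [← span_liftVec_image_span, hA] at hnormals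
  refine eq_top_iff.2 (le_trans (fun x _ => mem_span_liftVec_iff.2 fun f => ?_) hnormals)
  exact Submodule.mem_top

end BaseChange

section BaseChangeStrata

variable {F : Type*} [Field F] {d : ℕ} (K : Type*) [Field K] [Algebra F K]
  {A : Finset (AffineSubspace F (Fin d → F))} {Y : AffineSubspace F (Fin (d + 1) → F)}
  {Z : AffineSubspace F (Fin d → F)} {W : Submodule F (Fin d → F)}

theorem baseChange_subset_containingSpace_iff :
    (baseChange K Y : Set (Fin (d + 1) → K)) ⊆ containingSpace (baseChange K Z) ↔
      (Y : Set (Fin (d + 1) → F)) ⊆ containingSpace Z :=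
  calc (baseChange K Y : Set (Fin (d + 1) → K)) ⊆ containingSpace (baseChange K Z)
      ↔ ∀ P ∈ baseChange K Y, ∀ z ∈ Z, liftVec K z ∈ dualHyperplane P :=
        forall₂_congr fun _ _ => mem_containingSpace.trans (baseChange_le_iff K)
    _ ↔ ∀ z ∈ Z, baseChange K Y ≤ hyperplane (pair (liftVec K z) (-1)) 0 :=
        ⟨fun h z hz P hP => mem_hyperplane_pair_neg_one.2 (h P hP z hz),
          fun h _ hP z hz => mem_hyperplane_pair_neg_one.1 (h z hz hP)⟩
    _ ↔ ∀ z ∈ Z, ∀ P ∈ Y, z ∈ dualHyperplane P :=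
        forall₂_congr fun _ _ => (baseChange_le_iff K).trans <| forall₂_congr fun _ _ =>
          mem_hyperplane_pair_neg_one.trans (liftVec_mem_hyperplane_iff K)
    _ ↔ (Y : Set (Fin (d + 1) → F)) ⊆ containingSpace Z :=
        ⟨fun h P hP => mem_containingSpace.2 fun z hz => h z hz P hP,
          fun h _ hz _ hP => mem_containingSpace.1 (h hP) hz⟩

theorem liftVec_dotProduct_eq_zero_iff {ι : Type*} [Fintype ι] {α z : ι → F} :
    liftVec K α ⬝ᵥ liftVec K z = 0 ↔ α ⬝ᵥ z = 0 := by
  rw [← map_zero (algebraMap F K)]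
  exact liftVec_mem_hyperplane_iff K

theorem baseChange_subset_parallelSpace_iff :
    (baseChange K Y : Set (Fin (d + 1) → K)) ⊆
        parallelSpace (Submodule.span K (liftVec K '' (W : Set (Fin d → F)))) ↔
      (Y : Set (Fin (d + 1) → F)) ⊆ parallelSpace W :=
  calc (baseChange K Y : Set (Fin (d + 1) → K)) ⊆
        parallelSpace (Submodule.span K (liftVec K '' (W : Set (Fin d → F))))
      ↔ ∀ P ∈ baseChange K Y, ∀ u ∈ W, normal P ⬝ᵥ liftVec K u = 0 :=
        forall₂_congr fun _ _ => mem_parallelSpace_iff_le_ker.trans <|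
          Submodule.span_le.trans Set.forall_mem_image
    _ ↔ ∀ u ∈ W, baseChange K Y ≤ hyperplane (pair (liftVec K u) 0) 0 :=
        ⟨fun h u hu P hP => mem_hyperplane_pair_zero.2 (h P hP u hu),
          fun h _ hP u hu => mem_hyperplane_pair_zero.1 (h u hu hP)⟩
    _ ↔ ∀ u ∈ W, ∀ P ∈ Y, normal P ⬝ᵥ u = 0 :=
        forall₂_congr fun _ _ => (baseChange_le_iff K).trans <| forall₂_congr fun _ _ =>
          mem_hyperplane_pair_zero.trans (liftVec_dotProduct_eq_zero_iff K)
    _ ↔ (Y : Set (Fin (d + 1) → F)) ⊆ parallelSpace W :=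
        ⟨fun h P hP => mem_parallelSpace.2 fun u hu => h u hu P hP,
          fun h u hu _ hP => mem_parallelSpace.1 (h hP) u hu⟩

theorem cutPoly_baseChange (Z : AffineSubspace F (Fin d → F))
    (Y : AffineSubspace F (Fin (d + 1) → F)) :
    cutPoly (baseChange K Z) (baseChange K Y : Set (Fin (d + 1) → K)) = cutPoly Z Y := by
  by_cases hZ : Z = ⊥
  · rw [hZ, (baseChange_eq_bot_iff K).2 rfl, cutPoly_bot, cutPoly_bot]
  · have hdir := direction_baseChange K hZ
    refine cutPoly_congr (baseChange_eq_bot_iff K) ?_ (baseChange_subset_containingSpace_iff K) ?_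
    · rw [hdir, baseChange_subset_parallelSpace_iff]
    · rw [hdir, finrank_span_liftVec]

theorem strataPoly_baseChange (A : Finset (AffineSubspace F (Fin d → F)))
    (Y : AffineSubspace F (Fin (d + 1) → F)) :
    strataPoly (baseChangeArr K A) (baseChange K Y) = strataPoly A Y := by
  classical
  have hinj : Function.Injective (Finset.image (baseChange K : AffineSubspace F (Fin d → F) → _)) :=
    Finset.image_injective baseChange_injective
  rw [strataPoly, strataPoly, baseChangeArr, Finset.powerset_image, Finset.sum_image hinj.injOn]
  refine Finset.sum_congr rfl fun B _ => ?_
  rw [Finset.card_image_of_injective _ baseChange_injective, ← baseChange_finset_inf,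
    cutPoly_baseChange]

theorem IsEssential.isCommonCharPoly_baseChange (hA : IsEssential A)
    (Y : AffineSubspace F (Fin (d + 1) → F)) :
    IsCommonCharPoly (HypArr.baseChangeArr K A) (baseChange K Y) (strataPoly A Y) := by
  rw [← strataPoly_baseChange K]
  exact (hA.baseChangeArr K).isCommonCharPoly_strataPoly _

end BaseChangeStrata

end HypArr

theorem theorem2p3_general {F : Type*} [Field F] {d : ℕ} {A : Finset (AffineSubspace F (Fin d → F))}
    (hA : HypArr.IsEssential A) :
    ∃ χ : AffineSubspace F (Fin (d + 1) → F) → Polynomial ℤ,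
      (∀ Y ∈ HypArr.interLattice ⊤ (HypArr.adjoint A),
        HypArr.IsCommonCharPoly A Y (χ Y) ∧ (Infinite F → (HypArr.stratum A Y).Nonempty) ∧
        ∀ (K : Type*) [Field K] [Algebra F K],
          HypArr.IsCommonCharPoly (HypArr.baseChangeArr K A) (HypArr.baseChange K Y) (χ Y) ∧
          (Infinite K →
            (HypArr.stratum (HypArr.baseChangeArr K A) (HypArr.baseChange K Y)).Nonempty)) ∧
      ∑ Y ∈ HypArr.interLattice ⊤ (HypArr.adjoint A),
          HypArr.charPoly Y (HypArr.restriction (HypArr.adjoint A) Y) * χ Y =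
        Polynomial.X ^ d * (Polynomial.X - 1) * HypArr.charPoly ⊤ A := by
  refine ⟨HypArr.strataPoly A, fun Y hY => ?_, hA.sum_charPoly_mul_strataPoly⟩
  have hYne : Y ≠ ⊥ := (HypArr.mem_interLattice_iff.1 hY).1
  refine ⟨hA.isCommonCharPoly_strataPoly Y,
    fun _ => HypArr.complement_restriction_nonempty hYne, fun K _ _ => ?_⟩
  exact ⟨hA.isCommonCharPoly_baseChange K Y, fun _ => HypArr.complement_restriction_nonempty
    (mt (HypArr.baseChange_eq_bot_iff K).1 hYne)⟩

theorem theorem2p3 (d : ℕ) :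
    (∀ (F : Type u) [Field F] [Finite F] (A : Finset (AffineSubspace F (Fin d → F))),
      HypArr.IsArrangement A → HypArr.IsEssential A →
      ∃ χ : AffineSubspace F (Fin (d + 1) → F) → Polynomial ℤ,
        (∀ Y ∈ HypArr.interLattice ⊤ (HypArr.adjoint A),
          HypArr.IsCommonCharPoly A Y (χ Y) ∧
          ∀ (K : Type u) [Field K] [Algebra F K],
            HypArr.IsCommonCharPoly (HypArr.baseChangeArr K A) (HypArr.baseChange K Y) (χ Y) ∧
            (Infinite K →
              (HypArr.stratum (HypArr.baseChangeArr K A) (HypArr.baseChange K Y)).Nonempty)) ∧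
        ∑ Y ∈ HypArr.interLattice ⊤ (HypArr.adjoint A),
            HypArr.charPoly Y (HypArr.restriction (HypArr.adjoint A) Y) * χ Y =
          Polynomial.X ^ d * (Polynomial.X - 1) * HypArr.charPoly ⊤ A) ∧
    (∀ A : Finset (AffineSubspace ℝ (Fin d → ℝ)),
      HypArr.IsArrangement A → HypArr.IsEssential A → HypArr.IsRational A →
      ∃ χ : AffineSubspace ℝ (Fin (d + 1) → ℝ) → Polynomial ℤ,
        (∀ Y ∈ HypArr.interLattice ⊤ (HypArr.adjoint A),
          HypArr.IsCommonCharPoly A Y (χ Y) ∧ (HypArr.stratum A Y).Nonempty) ∧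
        ∑ Y ∈ HypArr.interLattice ⊤ (HypArr.adjoint A),
            HypArr.charPoly Y (HypArr.restriction (HypArr.adjoint A) Y) * χ Y =
          Polynomial.X ^ d * (Polynomial.X - 1) * HypArr.charPoly ⊤ A) := by
  constructor
  · intro F _ _ A _ hA
    obtain ⟨χ, hχ, hsum⟩ := theorem2p3_general hA
    exact ⟨χ, fun Y hY => ⟨(hχ Y hY).1, (hχ Y hY).2.2⟩, hsum⟩
  · intro A _ hA _
    obtain ⟨χ, hχ, hsum⟩ := theorem2p3_general.{0, 0} hA
    exact ⟨χ, fun Y hY => ⟨(hχ Y hY).1, (hχ Y hY).2.1 inferInstance⟩, hsum⟩
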